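/- Let $B$ be a unital C*-algebra and $X$ a right Hilbert $B$-module with $B$-valued inner product $\langle\cdot,\cdot\rangle$ (linear in the second variable). For $k\ge 1$ put $$\mathrm{Um}_k(X)=\Big\{(x_1,\dots,x_k)\in X^k:\ \sum_{i=1}^k\langle x_i,x_i\rangle \text{ is invertible in } B\Big\},$$ and define the stable rank $\mathrm{sr}(X)\in\{1,2,\dots\}\cup\{\infty\}$ as the least integer $k\ge 1$ such that $\mathrm{Um}_k(X)$ is dense in $X^k$, with $\mathrm{sr}(X)=\infty$ if there is no such $k$. For a unital C*-algebra $B$, let $\mathrm{sr}(B)$ be the stable rank of $B$ regarded as a right Hilbert module over itself with $\langle x,y\rangle=x^*y$. Let $A$ be a nonzero unital C*-algebra. (1) For all integers $n,m\ge 1$, regard the set $M_{n\times m}(A)$ of $n\times m$ matrices over $A$ as a right Hilbert module over $M_m(A)$, with action by matrix multiplication and inner product $\langle x,y\rangle=x^*y$. Then $$\mathrm{sr}(M_{n\times m}(A))=\left\lceil\frac{\mathrm{sr}(A)+m-1}{n}\right\rceil .$$ (2) In particular (Rieffel's formula), for every integer $n\ge 1$ the stable rank of the C*-algebra $M_n(A)$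 is $$\mathrm{sr}(M_n(A))=\left\lceil\frac{\mathrm{sr}(A)-1}{n}\right\rceil+1 .$$ In both formulas the right-hand side is read as $\infty$ when $\mathrm{sr}(A)=\infty$. -/

import Mathlib

open scoped InnerProductSpace WithCStarModule MulOpposite

/-- A right Hilbert module `X` over a unital C⋆-algebra `B`: the right action of `b` on `x` is
`MulOpposite.op b • x`, the `B`-valued inner product is linear in the second variable and
satisfies `⟨x, y · b⟩ = ⟨x, y⟩ b`, the norm of `X` is `‖⟨x, x⟩‖ ^ (1 / 2)`, and `X` is complete. -/
class RightHilbertModule (B X : Type*) [CStarAlgebra B] [PartialOrder B] [StarOrderedRing B]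
    [NormedAddCommGroup X] [NormedSpace ℂ X] [Module Bᵐᵒᵖ X] where
  /-- The `B`-valued inner product. -/
  bInner : X → X → B
  bInner_add_right : ∀ x y z : X, bInner x (y + z) = bInner x y + bInner x z
  bInner_smul_right : ∀ (c : ℂ) (x y : X), bInner x (c • y) = c • bInner x y
  bInner_op_smul_right : ∀ (b : B) (x y : X),
    bInner x (MulOpposite.op b • y) = bInner x y * b
  star_bInner : ∀ x y : X, star (bInner x y) = bInner y x
  bInner_self_nonneg : ∀ x : X, 0 ≤ bInner x x
  bInner_self_eq_zero : ∀ x : X, bInner x x = 0 ↔ x = 0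
  norm_eq_sqrt : ∀ x : X, ‖x‖ = √‖bInner x x‖
  complete : CompleteSpace X

section StableRank

variable (B X : Type*) [CStarAlgebra B] [PartialOrder B] [StarOrderedRing B]
  [NormedAddCommGroup X] [NormedSpace ℂ X] [Module Bᵐᵒᵖ X] [RightHilbertModule B X]

/-- The unimodular `k`-tuples of a right Hilbert `B`-module `X`: those `(x₁, …, x_k)` for which
`⟨x₁, x₁⟩ + ⋯ + ⟨x_k, x_k⟩` is invertible in `B`. -/
def unimodularTuples (k : ℕ) : Set (Fin k → X) :=
  {x | IsUnit (∑ i, RightHilbertModule.bInner (B := B) (x i) (x i))}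

/-- The stable rank of a right Hilbert `B`-module `X`: the least `k ≥ 1` such that the unimodular
`k`-tuples are dense in `X ^ k`, and `⊤` if there is no such `k`. -/
noncomputable def moduleStableRank : ℕ∞ :=
  sInf {r : ℕ∞ | ∃ k : ℕ, 1 ≤ k ∧ Dense (unimodularTuples B X k) ∧ r = k}

end StableRank

/-- A unital C⋆-algebra as a right Hilbert module over itself, with `⟨x, y⟩ = x⋆ y`. -/
noncomputable instance RightHilbertModule.self (B : Type*) [CStarAlgebra B] [PartialOrder B]
    [StarOrderedRing B] : RightHilbertModule B B where
  bInner x y := star x * y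
  bInner_add_right x y z := mul_add _ _ _
  bInner_smul_right c x y := mul_smul_comm _ _ _
  bInner_op_smul_right b x y := by simp [mul_assoc]
  star_bInner x y := by simp
  bInner_self_nonneg x := star_mul_self_nonneg x
  bInner_self_eq_zero x := CStarRing.star_mul_self_eq_zero_iff x
  norm_eq_sqrt x := by simp [CStarRing.norm_star_mul_self]
  complete := inferInstance

/-- The stable rank of a unital C⋆-algebra: its stable rank as a right Hilbert module over
itself. -/
noncomputable def algebraStableRank (B : Type*) [CStarAlgebra B] [PartialOrder B]
    [StarOrderedRing B] : ℕ∞ :=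
  moduleStableRank B B

namespace CStarMatrix

set_option linter.unusedSectionVars false

variable {m n A : Type*} [Fintype m] [Fintype n] [CStarAlgebra A] [PartialOrder A]
  [StarOrderedRing A]

theorem inner_toCLM_conjTranspose (M : CStarMatrix n m A) (v : C⋆ᵐᵒᵈ(A, n → A))
    (w : C⋆ᵐᵒᵈ(A, m → A)) : ⟪v, toCLM M.conjTranspose w⟫_A = ⟪toCLM M v, w⟫_A :=
  inner_toCLM_conjTranspose_right

theorem norm_conjTranspose_le (M : CStarMatrix n m A) : ‖M.conjTranspose‖ ≤ ‖M‖ := by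
  refine norm_le_of_forall_inner_le (C := ⟨‖M‖, norm_nonneg _⟩) fun v w ↦ ?_
  rw [inner_toCLM_conjTranspose]
  calc ‖⟪toCLM M w, v⟫_A‖ ≤ ‖toCLM M w‖ * ‖v‖ := CStarModule.norm_inner_le _
    _ ≤ (‖M‖ * ‖w‖) * ‖v‖ := by
        gcongr
        exact (toCLM M).le_opNorm w
    _ = ‖M‖ * ‖v‖ * ‖w‖ := by ring

theorem conjTranspose_conjTranspose' (M : CStarMatrix n m A) :
    M.conjTranspose.conjTranspose = M := by
  ext i j
  exact star_star (M i j)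

theorem norm_conjTranspose' (M : CStarMatrix n m A) : ‖M.conjTranspose‖ = ‖M‖ := by
  refine le_antisymm (norm_conjTranspose_le M) ?_
  simpa only [conjTranspose_conjTranspose'] using norm_conjTranspose_le M.conjTranspose

theorem toCLM_mul' (M : CStarMatrix n m A) (N : CStarMatrix m n A) :
    toCLM (M * N) = (toCLM N).comp (toCLM M) := by
  ext v i
  exact (congrFun (Matrix.vecMul_vecMul v M N) i).symm

theorem norm_eq_sqrt_mul_conjTranspose (M : CStarMatrix n m A) :
    ‖M‖ = √‖M * M.conjTranspose‖ := by
  have hcomp : ‖M * M.conjTranspose‖ = ‖(toCLM M.conjTranspose).comp (toCLM M)‖ := by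
    rw [norm_def, toCLM_mul']
  refine le_antisymm ?_ ?_
  · rw [norm_def, ContinuousLinearMap.opNorm_le_iff (by positivity)]
    intro v
    rw [CStarModule.norm_eq_sqrt_norm_inner_self (A := A), ← inner_toCLM_conjTranspose]
    have h₁ : ‖⟪v, (toCLM M.conjTranspose) ((toCLM M) v)⟫_A‖
        ≤ ‖M * M.conjTranspose‖ * ‖v‖ ^ 2 := by
      calc ‖⟪v, (toCLM M.conjTranspose) ((toCLM M) v)⟫_A‖
          ≤ ‖v‖ * ‖(toCLM M.conjTranspose) (toCLM M v)‖ :=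
            CStarModule.norm_inner_le (C⋆ᵐᵒᵈ(A, n → A))
        _ ≤ ‖v‖ * (‖(toCLM M.conjTranspose).comp (toCLM M)‖ * ‖v‖) := by
            gcongr
            exact ((toCLM M.conjTranspose).comp (toCLM M)).le_opNorm v
        _ = ‖M * M.conjTranspose‖ * ‖v‖ ^ 2 := by rw [hcomp]; ring
    have h₂ : ‖v‖ = √(‖v‖ ^ 2) := by simp
    rw [h₂, ← Real.sqrt_mul (norm_nonneg _)]
    exact Real.sqrt_le_sqrt h₁
  · refine Real.sqrt_le_iff.2 ⟨norm_nonneg _, ?_⟩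
    rw [hcomp]
    calc ‖(toCLM M.conjTranspose).comp (toCLM M)‖
        ≤ ‖toCLM M.conjTranspose‖ * ‖toCLM M‖ := ContinuousLinearMap.opNorm_comp_le _ _
      _ = ‖M.conjTranspose‖ * ‖M‖ := rfl
      _ = ‖M‖ ^ 2 := by rw [norm_conjTranspose']; ring

theorem norm_eq_sqrt_conjTranspose_mul (M : CStarMatrix n m A) :
    ‖M‖ = √‖M.conjTranspose * M‖ := by
  have h := norm_eq_sqrt_mul_conjTranspose M.conjTranspose
  rwa [norm_conjTranspose', conjTranspose_conjTranspose'] at h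

variable [DecidableEq m]

theorem conjTranspose_mul_self_nonneg (M : CStarMatrix n m A) :
    0 ≤ M.conjTranspose * M := by
  rcases isEmpty_or_nonempty m with hm | ⟨⟨j₀⟩⟩
  · exact le_of_eq (ext fun i ↦ isEmptyElim i)
  · have h : M.conjTranspose * M = ∑ i : n,
        star (ofMatrix fun k j ↦ if k = j₀ then M i j else 0 : CStarMatrix m m A) *
          (ofMatrix fun k j ↦ if k = j₀ then M i j else 0 : CStarMatrix m m A) := by
      ext k l
      have hs : ∀ (f : n → CStarMatrix m m A), (∑ i, f i) k l = ∑ i, f i k l := fun f ↦ by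
        have := Matrix.sum_apply k l Finset.univ (fun i ↦ ofMatrix.symm (f i))
        exact this
      rw [hs, mul_apply]
      refine Finset.sum_congr rfl fun i _ ↦ ?_
      rw [mul_apply, Finset.sum_eq_single j₀]
      · change star (M i k) * M i l =
          star (if j₀ = j₀ then M i k else 0) * (if j₀ = j₀ then M i l else 0)
        simp only [if_true]
      · intro b _ hb
        change star (if b = j₀ then M i k else 0) * (if b = j₀ then M i l else 0) = 0
        simp only [if_neg hb, mul_zero]
      · simp
    rw [h]
    exact Finset.sum_nonneg fun i _ ↦ star_mul_self_nonneg _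

/-- The right action of `M_m(A)` on `M_{n × m}(A)` by matrix multiplication. -/
instance rightModule : Module (CStarMatrix m m A)ᵐᵒᵖ (CStarMatrix n m A) where
  smul b x := x * b.unop
  one_smul x := Matrix.mul_one (ofMatrix.symm x)
  mul_smul b c x := (Matrix.mul_assoc (ofMatrix.symm x) c.unop b.unop).symm
  smul_zero _ := Matrix.zero_mul _
  smul_add _ _ _ := Matrix.add_mul _ _ _
  add_smul _ _ _ := Matrix.mul_add _ _ _
  zero_smul _ := Matrix.mul_zero _

/-- `M_{n × m}(A)` as a right Hilbert module over `M_m(A)`, with the action by matrix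
multiplication and `⟨x, y⟩ = x⋆ y`. -/
noncomputable instance rightHilbertModule :
    RightHilbertModule (CStarMatrix m m A) (CStarMatrix n m A) where
  bInner x y := x.conjTranspose * y
  bInner_add_right x y z := Matrix.mul_add _ _ _
  bInner_smul_right c x y := Matrix.mul_smul _ _ _
  bInner_op_smul_right b x y := (Matrix.mul_assoc _ _ _).symm
  star_bInner x y := by
    rw [star_eq_conjTranspose]
    exact (Matrix.conjTranspose_mul _ _).trans
      (congrArg (fun z ↦ Matrix.conjTranspose y * z) (Matrix.conjTranspose_conjTranspose x))
  bInner_self_nonneg x := conjTranspose_mul_self_nonneg x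
  bInner_self_eq_zero x := by
    rw [← norm_eq_zero (a := x), norm_eq_sqrt_conjTranspose_mul,
      Real.sqrt_eq_zero (norm_nonneg _), norm_eq_zero]
  norm_eq_sqrt x := norm_eq_sqrt_conjTranspose_mul x
  complete := inferInstance

end CStarMatrix

/-! Stacking a `k`-tuple of `n × m` matrices gives one `kn × m` matrix `X`, and the sum of the inner
products is `X⋆X`, which is invertible exactly when `X` is left invertible. So everything depends on
`D(N, m)`: the left invertible `N × m` matrices over `A` are dense. The core is `D(N + 1, m + 1) ↔
D(N, m)` for `m ≥ 1` (`dense_leftInvertible_succ_succ_iff`). Downwards, take Schur complements near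
`diag(Y, 1)`; upwards, make the last column left invertible and use it to clear that column by row
operations. Iterating reduces to single columns: `D(N, m)` says `sr(A) ≤ N + 1 - m`. With `N = kn`
this reads `k ≥ (sr(A) + m - 1) / n`. Rieffel's formula is the case `n = m`. -/

namespace Matrix

set_option linter.unusedSectionVars false

/-- The left invertible `ι × κ` matrices over a ring. -/
def leftInvertible (ι κ R : Type*) [Fintype ι] [DecidableEq κ] [Ring R] : Set (Matrix ι κ R) :=
  {X | ∃ Z : Matrix κ ι R, Z * X = 1}

/-! ### Algebra of left invertible matrices -/

section Ring

variable {ι κ o R : Type*} [Fintype ι] [Fintype κ] [Fintype o] [DecidableEq ι] [DecidableEq κ]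
  [DecidableEq o] [Ring R]

theorem mul_mem_leftInvertible {X : Matrix ι κ R} (hX : X ∈ leftInvertible ι κ R)
    {P Q : Matrix ι ι R} (hQP : Q * P = 1) : P * X ∈ leftInvertible ι κ R := by
  obtain ⟨Z, hZ⟩ := hX
  refine ⟨Z * Q, ?_⟩
  rw [Matrix.mul_assoc, ← Matrix.mul_assoc Q, hQP, Matrix.one_mul, hZ]

theorem fromBlocks_zero_one_mem_leftInvertible {Y : Matrix ι κ R}
    (hY : Y ∈ leftInvertible ι κ R) (z : Matrix o κ R) :
    fromBlocks Y 0 z 1 ∈ leftInvertible (ι ⊕ o) (κ ⊕ o) R := by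
  obtain ⟨p, hp⟩ := hY
  refine ⟨fromBlocks p 0 (-(z * p)) 1, ?_⟩
  rw [fromBlocks_multiply, ← fromBlocks_one]
  congr 1 <;> simp [hp, Matrix.mul_assoc]

/-- If the last diagonal block is invertible, the Schur complement of a left invertible matrix is
left invertible. -/
theorem schurComplement_mem_leftInvertible {a : Matrix ι κ R} {b : Matrix ι o R}
    {c : Matrix o κ R} {e f : Matrix o o R} (hef : e * f = 1)
    (h : fromBlocks a b c e ∈ leftInvertible (ι ⊕ o) (κ ⊕ o) R) :
    a - b * f * c ∈ leftInvertible ι κ R := by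
  obtain ⟨Z, hZ⟩ := h
  rw [← fromBlocks_toBlocks Z, fromBlocks_multiply, ← fromBlocks_one] at hZ
  obtain ⟨h₁, h₂, -, -⟩ := fromBlocks_inj.1 hZ
  -- The upper right block of `Z * X = 1` turns `Z₁₁ b` into `-Z₁₂ e`, so `Z₁₁ (a - b f c) = Z₁₁ a +
  -- Z₁₂ c = 1`.
  refine ⟨Z.toBlocks₁₁, ?_⟩
  have h₃ : Z.toBlocks₁₁ * b = -(Z.toBlocks₁₂ * e) := eq_neg_of_add_eq_zero_left h₂
  rw [Matrix.mul_sub, ← Matrix.mul_assoc, ← Matrix.mul_assoc, h₃, ← h₁, Matrix.neg_mul,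
    Matrix.mul_assoc _ e f, hef, Matrix.mul_one, Matrix.neg_mul, sub_neg_eq_add]

end Ring

/-! ### Density under changes of size -/

section Topology

variable {ι ι' κ κ' o R : Type*} [Fintype ι] [Fintype ι'] [Fintype κ] [Fintype o]
  [DecidableEq ι] [DecidableEq κ] [DecidableEq κ'] [DecidableEq o]

theorem dense_leftInvertible_submatrix [Ring R] [TopologicalSpace R]
    (e : ι' ≃ ι) {g : κ' → κ} (hg : Function.Injective g) (h : Dense (leftInvertible ι κ R)) :
    Dense (leftInvertible ι' κ' R) := by
  have hs : Function.Surjective fun X : Matrix ι κ R ↦ X.submatrix e g := fun Y ↦ by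
    refine ⟨of fun i ↦ Function.extend g (Y (e.symm i)) 0, ?_⟩
    ext i j
    simp [hg.extend_apply]
  refine (hs.denseRange.dense_image (continuous_id.matrix_submatrix _ _) h).mono ?_
  rintro _ ⟨X, ⟨Z, hZ⟩, rfl⟩
  refine ⟨Z.submatrix g e, ?_⟩
  rw [← submatrix_mul _ _ _ _ _ e.bijective, hZ, submatrix_one g hg]

theorem dense_leftInvertible_sum_left [Ring R] [TopologicalSpace R]
    (h : Dense (leftInvertible ι κ R)) : Dense (leftInvertible (ι ⊕ o) κ R) := by
  have hs : Function.Surjective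
      fun p : Matrix ι κ R × Matrix o κ R ↦ fromRows p.1 p.2 := fun X ↦
    ⟨(X.toRows₁, X.toRows₂), fromRows_toRows X⟩
  have hc : Continuous fun p : Matrix ι κ R × Matrix o κ R ↦ fromRows p.1 p.2 := by
    refine continuous_matrix fun i j ↦ ?_
    rcases i with i | i
    · exact continuous_fst.matrix_elem i j
    · exact continuous_snd.matrix_elem i j
  refine (hs.denseRange.dense_image hc (h.prod dense_univ)).mono ?_
  rintro _ ⟨⟨X, Y⟩, ⟨⟨Z, hZ⟩, -⟩, rfl⟩
  exact ⟨fromCols Z 0, by simp [fromCols_mul_fromRows, hZ]⟩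

/-- After a perturbation the last block column has upper part `v` with `w v = 1`. Adding `(1 - t) w`
times the upper rows to the lower ones turns the corner `t` into `1`, which then clears `v`. What
remains to perturb is the single block `Y - v z'`. -/
theorem dense_leftInvertible_sum_sum [Ring R] [TopologicalSpace R] [IsTopologicalRing R]
    (h : Dense (leftInvertible ι κ R)) (ho : Dense (leftInvertible ι o R)) :
    Dense (leftInvertible (ι ⊕ o) (κ ⊕ o) R) := by
  have hs : Function.Surjective fun p : Matrix ι o R × Matrix ι κ R × Matrix o κ R × Matrix o o R ↦
      fromBlocks p.2.1 p.1 p.2.2.1 p.2.2.2 := fun X ↦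
    ⟨(X.toBlocks₁₂, X.toBlocks₁₁, X.toBlocks₂₁, X.toBlocks₂₂), fromBlocks_toBlocks X⟩
  have hc : Continuous fun p : Matrix ι o R × Matrix ι κ R × Matrix o κ R × Matrix o o R ↦
      fromBlocks p.2.1 p.1 p.2.2.1 p.2.2.2 := by
    refine Continuous.matrix_fromBlocks ?_ ?_ ?_ ?_ <;> fun_prop
  -- It suffices that the closure is dense, so only matrices whose `v` is already left invertible
  -- need approximating.
  rw [← dense_closure]
  refine (hs.denseRange.dense_image hc (ho.prod dense_univ)).mono ?_
  rintro _ ⟨⟨v, Y, z, t⟩, ⟨⟨w, hw⟩, -⟩, rfl⟩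
  change w * v = 1 at hw
  set z' := z + (1 - t) * w * Y with hz'
  let P : Matrix (ι ⊕ o) (ι ⊕ o) R :=
    (fromBlocks 1 0 (-((1 - t) * w)) 1 : Matrix (ι ⊕ o) (ι ⊕ o) R) * fromBlocks 1 v 0 1
  let Q : Matrix (ι ⊕ o) (ι ⊕ o) R :=
    (fromBlocks 1 (-v) 0 1 : Matrix (ι ⊕ o) (ι ⊕ o) R) * fromBlocks 1 0 ((1 - t) * w) 1
  have hQP : Q * P = 1 := by
    have h₁ : (fromBlocks 1 0 ((1 - t) * w) 1 : Matrix (ι ⊕ o) (ι ⊕ o) R) *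
        fromBlocks 1 0 (-((1 - t) * w)) 1 = 1 := by
      rw [fromBlocks_multiply, ← fromBlocks_one]; congr 1 <;> simp
    have h₂ : (fromBlocks 1 (-v) 0 1 : Matrix (ι ⊕ o) (ι ⊕ o) R) * fromBlocks 1 v 0 1 = 1 := by
      rw [fromBlocks_multiply, ← fromBlocks_one]; congr 1 <;> simp
    simp only [P, Q]
    rw [Matrix.mul_assoc, ← Matrix.mul_assoc _ _ (fromBlocks 1 v 0 1 :
      Matrix (ι ⊕ o) (ι ⊕ o) R), h₁, Matrix.one_mul, h₂]
  have hX : fromBlocks Y v z t = P * fromBlocks (Y - v * z') 0 z' 1 := by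
    simp only [P]
    rw [Matrix.mul_assoc, fromBlocks_multiply, fromBlocks_multiply]
    congr 1
    · simp
    · simp
    · simp [hz']
    · simp [Matrix.mul_assoc, hw]
  have hcont : Continuous fun Y' : Matrix ι κ R ↦
      P * (fromBlocks Y' 0 z' 1 : Matrix (ι ⊕ o) (κ ⊕ o) R) :=
    continuous_const.matrix_mul (continuous_id.matrix_fromBlocks continuous_const
      continuous_const continuous_const)
  change fromBlocks Y v z t ∈ _
  rw [hX]
  exact map_mem_closure (f := fun Y' : Matrix ι κ R ↦
    P * (fromBlocks Y' 0 z' 1 : Matrix (ι ⊕ o) (κ ⊕ o) R)) hcont (h (Y - v * z')) fun Y' hY' ↦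
    mul_mem_leftInvertible (fromBlocks_zero_one_mem_leftInvertible hY' z') hQP

/-- The Schur complement map `Φ` is continuous at `diag(Y, 1)`, where its value is `Y`, and near
that point the corner stays a unit. Hence `Φ` carries left invertible matrices close to `diag(Y, 1)`
to left invertible ones close to `Y`. -/
theorem dense_leftInvertible_of_sum_unit [NormedRing R] [HasSummableGeomSeries R]
    (h : Dense (leftInvertible (ι ⊕ Unit) (κ ⊕ Unit) R)) : Dense (leftInvertible ι κ R) := by
  intro Y
  let Φ : Matrix (ι ⊕ Unit) (κ ⊕ Unit) R → Matrix ι κ R := fun X ↦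
    X.toBlocks₁₁ - X.toBlocks₁₂ * (of fun _ _ ↦ Ring.inverse (X (.inr ()) (.inr ())) : Matrix Unit Unit R) *
      X.toBlocks₂₁
  let X₀ : Matrix (ι ⊕ Unit) (κ ⊕ Unit) R := fromBlocks Y 0 0 1
  have he : ∀ i j, ContinuousAt (fun X : Matrix (ι ⊕ Unit) (κ ⊕ Unit) R ↦ X i j) X₀ :=
    fun i j ↦ (continuous_id.matrix_elem i j).continuousAt
  have hev : Filter.Tendsto (fun X : Matrix (ι ⊕ Unit) (κ ⊕ Unit) R ↦ X (.inr ()) (.inr ()))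
      (nhds X₀) (nhds ((1 : Rˣ) : R)) := by
    simpa [ContinuousAt, X₀] using he (.inr ()) (.inr ())
  have hinv : ContinuousAt (fun X : Matrix (ι ⊕ Unit) (κ ⊕ Unit) R ↦
      Ring.inverse (X (.inr ()) (.inr ()))) X₀ := by
    have := (NormedRing.inverse_continuousAt (1 : Rˣ)).tendsto.comp hev
    simpa [ContinuousAt, X₀, Function.comp_def] using this
  have hΦ : Filter.Tendsto Φ (nhds X₀) (nhds Y) := by
    have hΦ₀ : Φ X₀ = Y := by simp [Φ, X₀]
    have hcont : ContinuousAt Φ X₀ := by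
      refine continuousAt_pi.2 fun i ↦ continuousAt_pi.2 fun j ↦ ?_
      have hij : (fun X ↦ Φ X i j) = fun X ↦ X (.inl i) (.inl j) -
          X (.inl i) (.inr ()) * Ring.inverse (X (.inr ()) (.inr ())) * X (.inr ()) (.inl j) := by
        ext X
        simp [Φ, Matrix.mul_apply, toBlocks₁₁, toBlocks₁₂, toBlocks₂₁]
      rw [hij]
      exact (he _ _).sub (((he _ _).mul hinv).mul (he _ _))
    simpa only [hΦ₀] using hcont.tendsto
  have hunit : ∀ᶠ X in nhds X₀, IsUnit (X (.inr ()) (.inr ())) :=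
    hev.eventually (Units.nhds 1)
  refine mem_closure_iff_frequently.2 (hΦ.frequently ?_)
  refine ((mem_closure_iff_frequently.1 (h X₀)).and_eventually hunit).mono ?_
  rintro X ⟨hX, hu⟩
  rw [← fromBlocks_toBlocks X] at hX
  refine schurComplement_mem_leftInvertible ?_ hX
  ext
  simp [Matrix.mul_apply, toBlocks₂₂, Ring.mul_inverse_cancel _ hu]

end Topology

/-! ### Reduction to a single column -/

section Fin

variable {R : Type*} [NormedRing R] [HasSummableGeomSeries R]

theorem dense_leftInvertible_succ_succ_iff {N m : ℕ} (hm : 1 ≤ m) :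
    Dense (leftInvertible (Fin (N + 1)) (Fin (m + 1)) R) ↔
      Dense (leftInvertible (Fin N) (Fin m) R) := by
  have e : ∀ k : ℕ, Fin k ⊕ Unit ≃ Fin (k + 1) := fun k ↦ Fintype.equivOfCardEq (by simp)
  refine ⟨fun h ↦ dense_leftInvertible_of_sum_unit
    (dense_leftInvertible_submatrix (e N) (e m).injective h), fun h ↦ ?_⟩
  refine dense_leftInvertible_submatrix (e N).symm (e m).symm.injective
    (dense_leftInvertible_sum_sum h ?_)
  -- Density for one column follows by keeping only column `0`, which exists because `m ≥ 1`.
  exact dense_leftInvertible_submatrix (Equiv.refl _) (g := fun _ ↦ ⟨0, hm⟩)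
    (Function.injective_of_subsingleton _) h

theorem not_dense_leftInvertible_zero [Nontrivial R] {m : ℕ} (hm : 1 ≤ m) :
    ¬ Dense (leftInvertible (Fin 0) (Fin m) R) := by
  intro h
  obtain ⟨X, Z, hZ⟩ := h.nonempty
  have := congrFun (congrFun hZ ⟨0, hm⟩) ⟨0, hm⟩
  simp [Matrix.mul_apply] at this

theorem dense_leftInvertible_iff_column [Nontrivial R] {m : ℕ} (hm : 1 ≤ m) (N : ℕ) :
    Dense (leftInvertible (Fin N) (Fin m) R) ↔
      m ≤ N ∧ Dense (leftInvertible (Fin (N + 1 - m)) (Fin 1) R) := by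
  induction m, hm using Nat.le_induction generalizing N with
  | base =>
    rcases N with _ | N
    · simpa using not_dense_leftInvertible_zero (R := R) le_rfl
    · simp
  | succ m hm ih =>
    rcases N with _ | N
    · simpa using not_dense_leftInvertible_zero (R := R) m.succ_pos
    · rw [dense_leftInvertible_succ_succ_iff hm, ih, Nat.add_sub_add_right, Nat.add_le_add_iff_right]

theorem dense_leftInvertible_mono {N N' m : ℕ} (hN : N ≤ N')
    (h : Dense (leftInvertible (Fin N) (Fin m) R)) :
    Dense (leftInvertible (Fin N') (Fin m) R) :=
  dense_leftInvertible_submatrix (ι := Fin N ⊕ Fin (N' - N))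
    (Fintype.equivOfCardEq (by simp; omega)) Function.injective_id (dense_leftInvertible_sum_left h)

end Fin

end Matrix

/-! ### Left invertibility and invertibility of `X⋆X` -/

theorem IsSelfAdjoint.exists_star_mul_self_eq_smul_one_sub {B : Type*} [CStarAlgebra B]
    [PartialOrder B] [StarOrderedRing B] {P : B} (hP : IsSelfAdjoint P) :
    ∃ c : ℂ, c ≠ 0 ∧ ∃ S : B, star S * S = c • 1 - P := by
  have hc : (0 : ℝ) < ‖P‖ + 1 := by positivity
  have h : 0 ≤ algebraMap ℝ B (‖P‖ + 1) - P := by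
    rw [sub_nonneg]
    refine hP.le_algebraMap_norm_self.trans (algebraMap_mono _ ?_)
    simp
  obtain ⟨S, hS⟩ := CStarAlgebra.nonneg_iff_eq_star_mul_self.1 h
  -- The summand `1` keeps the constant nonzero even when `P = 0`.
  refine ⟨((‖P‖ + 1 : ℝ) : ℂ), by exact_mod_cast hc.ne', S, ?_⟩
  rw [← hS, Algebra.algebraMap_eq_smul_one, Complex.coe_smul]

namespace CStarMatrix

/-- If `Z X = 1`, compressing `c - Z⋆Z = T⋆T` by `X` gives `c X⋆X - 1 = (T X)⋆(T X) ≥ 0`. Thus `c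
X⋆X ≥ 1` is invertible. -/
theorem isUnit_conjTranspose_mul_self_iff {m n A : Type*} [Fintype m] [Fintype n] [DecidableEq m]
    [CStarAlgebra A] [PartialOrder A] [StarOrderedRing A] (X : Matrix n m A) :
    IsUnit (X.conjTranspose * X) ↔ ∃ Z : Matrix m n A, Z * X = 1 := by
  classical
  constructor
  · rintro ⟨u, hu⟩
    exact ⟨u⁻¹.val * X.conjTranspose, by rw [Matrix.mul_assoc, ← hu, Units.inv_mul]⟩
  · rintro ⟨Z, hZ⟩
    obtain ⟨c, hc, S, hS⟩ := IsSelfAdjoint.exists_star_mul_self_eq_smul_one_sub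
      (conjTranspose_mul_self_nonneg (ofMatrix Z)).isSelfAdjoint
    let T : Matrix n n A := S
    have hT : T.conjTranspose * T = c • (1 : Matrix n n A) - Z.conjTranspose * Z := hS
    have key : (T * X).conjTranspose * (T * X) = c • (X.conjTranspose * X) - 1 := by
      rw [Matrix.conjTranspose_mul, Matrix.mul_assoc, ← Matrix.mul_assoc T.conjTranspose,
        hT, Matrix.sub_mul, Matrix.mul_sub, Matrix.smul_mul, Matrix.one_mul, Matrix.mul_smul,
        Matrix.mul_assoc, hZ, Matrix.mul_one, ← Matrix.conjTranspose_mul, hZ,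
        Matrix.conjTranspose_one]
    have h1 : (1 : CStarMatrix m m A) ≤ c • ofMatrix (X.conjTranspose * X) := by
      rw [← sub_nonneg]
      exact (conjTranspose_mul_self_nonneg (ofMatrix (T * X))).trans_eq key
    have h2 : IsUnit (c • (X.conjTranspose * X)) :=
      CStarAlgebra.isUnit_of_le (1 : CStarMatrix m m A) h1
    exact (isUnit_smul_iff (Units.mk0 c hc) _).1 h2

end CStarMatrix

open Matrix (leftInvertible)

/-! ### Translation to stable ranks -/

section StableRank

theorem Homeomorph.dense_preimage_iff {X Y : Type*} [TopologicalSpace X] [TopologicalSpace Y]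
    (e : X ≃ₜ Y) {s : Set Y} : Dense (e ⁻¹' s) ↔ Dense s := by
  refine ⟨fun h ↦ ?_, fun h ↦ h.preimage e.isOpenMap⟩
  rw [← Set.image_preimage_eq s e.surjective]
  exact e.surjective.denseRange.dense_image e.continuous h

theorem dense_unimodularTuples_cstarMatrix_iff {A : Type*} [CStarAlgebra A] [PartialOrder A]
    [StarOrderedRing A] (k n m : ℕ) :
    Dense (unimodularTuples (CStarMatrix (Fin m) (Fin m) A) (CStarMatrix (Fin n) (Fin m) A) k) ↔
      Dense (leftInvertible (Fin (k * n)) (Fin m) A) := by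
  let e : (Fin k → Matrix (Fin n) (Fin m) A) ≃ₜ Matrix (Fin (k * n)) (Fin m) A :=
    { toFun := fun x ↦ .of fun p j ↦ x (finProdFinEquiv.symm p).1 (finProdFinEquiv.symm p).2 j
      invFun := fun X i ↦ .of fun p j ↦ X (finProdFinEquiv (i, p)) j
      left_inv := fun x ↦ by ext; simp only [Matrix.of_apply, Equiv.symm_apply_apply]
      right_inv := fun X ↦ by ext; simp only [Matrix.of_apply, Prod.mk.eta, Equiv.apply_symm_apply]
      continuous_toFun := continuous_matrix fun p j ↦
        (continuous_apply (finProdFinEquiv.symm p).1).matrix_elem (finProdFinEquiv.symm p).2 j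
      continuous_invFun := continuous_pi fun i ↦ continuous_matrix fun p j ↦
        continuous_id.matrix_elem _ _ }
  have he : unimodularTuples (CStarMatrix (Fin m) (Fin m) A) (CStarMatrix (Fin n) (Fin m) A) k =
      e ⁻¹' leftInvertible (Fin (k * n)) (Fin m) A := by
    refine Set.ext fun (x : Fin k → Matrix (Fin n) (Fin m) A) ↦ ?_
    have hex : ∀ i p j, e x (finProdFinEquiv (i, p)) j = x i p j := fun i p j ↦
      congrFun (congrFun (congrFun (e.symm_apply_apply x) i) p) j
    have hx : ∑ i, (Matrix.conjTranspose (x i) * x i : Matrix (Fin m) (Fin m) A) =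
        (e x).conjTranspose * e x := by
      ext a b
      rw [Matrix.sum_apply, Matrix.mul_apply, ← finProdFinEquiv.sum_comp, Fintype.sum_prod_type]
      refine Finset.sum_congr rfl fun i _ ↦ ?_
      rw [Matrix.mul_apply]
      refine Finset.sum_congr rfl fun p _ ↦ ?_
      rw [Matrix.conjTranspose_apply, Matrix.conjTranspose_apply, hex, hex]
    exact (iff_of_eq (congrArg IsUnit hx)).trans
      (CStarMatrix.isUnit_conjTranspose_mul_self_iff (e x))
  rw [he]
  exact e.dense_preimage_iff

theorem dense_unimodularTuples_self_iff {A : Type*} [CStarAlgebra A] [PartialOrder A]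
    [StarOrderedRing A] (k : ℕ) :
    Dense (unimodularTuples A A k) ↔ Dense (leftInvertible (Fin k) (Fin 1) A) := by
  let e : (Fin k → A) ≃ₜ Matrix (Fin k) (Fin 1) A :=
    { toFun := fun x ↦ .of fun p _ ↦ x p
      invFun := fun X i ↦ X i 0
      left_inv := fun x ↦ by ext; simp
      right_inv := fun X ↦ by ext i j; simp [Subsingleton.elim j 0]
      continuous_toFun := continuous_matrix fun p j ↦ continuous_apply _
      continuous_invFun := continuous_pi fun i ↦ continuous_id.matrix_elem _ _ }
  have he : unimodularTuples A A k = e ⁻¹' leftInvertible (Fin k) (Fin 1) A := by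
    ext x
    have hx : ∑ i, star (x i) * x i =
        (Matrix.uniqueRingEquiv : Matrix (Fin 1) (Fin 1) A ≃+* A)
          ((e x).conjTranspose * e x) := by
      simp [e, Matrix.mul_apply]
    exact (iff_of_eq (congrArg IsUnit hx)).trans ((MulEquiv.isUnit_map _).trans
      (CStarMatrix.isUnit_conjTranspose_mul_self_iff (e x)))
  rw [he]
  exact e.dense_preimage_iff

theorem ENat.sInf_setOf_natCast_eq {P : ℕ → Prop} {s : ℕ} (hs : 1 ≤ s)
    (hP : ∀ k, 1 ≤ k → (P k ↔ s ≤ k)) :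
    sInf {r : ℕ∞ | ∃ k : ℕ, 1 ≤ k ∧ P k ∧ r = k} = s := by
  refine le_antisymm (sInf_le ⟨s, hs, (hP s hs).2 le_rfl, rfl⟩) (le_sInf ?_)
  rintro _ ⟨k, hk, hPk, rfl⟩
  exact_mod_cast (hP k hk).1 hPk

theorem moduleStableRank_cstarMatrix {A : Type*} [CStarAlgebra A] [PartialOrder A]
    [StarOrderedRing A] [Nontrivial A] {n m : ℕ} (hn : 1 ≤ n) (hm : 1 ≤ m) :
    moduleStableRank (CStarMatrix (Fin m) (Fin m) A) (CStarMatrix (Fin n) (Fin m) A) =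
      (algebraStableRank A).map fun s : ℕ ↦ ⌈((s : ℚ) + m - 1) / n⌉₊ := by
  classical
  unfold algebraStableRank moduleStableRank
  have hP := fun k ↦ (dense_unimodularTuples_cstarMatrix_iff (A := A) k n m).trans
    (Matrix.dense_leftInvertible_iff_column hm _)
  simp only [hP, dense_unimodularTuples_self_iff]
  by_cases h : ∃ k, Dense (leftInvertible (Fin k) (Fin 1) A)
  · obtain ⟨s, hmin⟩ : ∃ s, ∀ k, Dense (leftInvertible (Fin k) (Fin 1) A) ↔ s ≤ k :=
      ⟨Nat.find h, fun k ↦ ⟨Nat.find_min' h, fun hk ↦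
        Matrix.dense_leftInvertible_mono hk (Nat.find_spec h)⟩⟩
    -- Excluding `s = 0` makes the restriction `k ≥ 1` in the stable rank harmless.
    have hpos : 1 ≤ s := Nat.one_le_iff_ne_zero.2 fun hs ↦
      Matrix.not_dense_leftInvertible_zero le_rfl ((hmin 0).2 hs.le)
    simp only [hmin]
    have hn' : (0 : ℚ) < n := by exact_mod_cast hn
    have hpos' : (1 : ℚ) ≤ s := by exact_mod_cast hpos
    have hm' : (1 : ℚ) ≤ m := by exact_mod_cast hm
    rw [ENat.sInf_setOf_natCast_eq hpos fun _ _ ↦ Iff.rfl, ENat.map_natCast]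
    refine ENat.sInf_setOf_natCast_eq ?_ fun k _ ↦ ?_
    · exact Nat.one_le_ceil_iff.2 (div_pos (by linarith) hn')
    · have hcast : (s : ℚ) + m - 1 ≤ k * n ↔ s + m ≤ k * n + 1 := by
        rw [sub_le_iff_le_add]
        exact_mod_cast Iff.rfl
      rw [Nat.ceil_le, div_le_iff₀ hn', hcast]
      omega
  · push Not at h
    simp only [h, and_false, false_and, exists_const, Set.ofPred_false, sInf_empty]
    rfl

end StableRank

theorem mainTheorem5 {A : Type*} [CStarAlgebra A] [PartialOrder A] [StarOrderedRing A]
    [Nontrivial A] :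
    (∀ n m : ℕ, 1 ≤ n → 1 ≤ m →
      moduleStableRank (CStarMatrix (Fin m) (Fin m) A) (CStarMatrix (Fin n) (Fin m) A) =
        (algebraStableRank A).map fun s : ℕ ↦ ⌈((s : ℚ) + m - 1) / n⌉₊) ∧
    (∀ n : ℕ, 1 ≤ n →
      algebraStableRank (CStarMatrix (Fin n) (Fin n) A) =
        (algebraStableRank A).map fun s : ℕ ↦ ⌈((s : ℚ) - 1) / n⌉₊ + 1) := by
  refine ⟨fun n m hn hm ↦ moduleStableRank_cstarMatrix hn hm, fun n hn ↦ ?_⟩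
  have hself : algebraStableRank (CStarMatrix (Fin n) (Fin n) A) =
      moduleStableRank (CStarMatrix (Fin n) (Fin n) A) (CStarMatrix (Fin n) (Fin n) A) := rfl
  have hrank : 1 ≤ algebraStableRank A := le_sInf (by
    rintro _ ⟨k, hk, -, rfl⟩
    exact_mod_cast hk)
  rw [hself, moduleStableRank_cstarMatrix hn hn]
  have hn' : (n : ℚ) ≠ 0 := by exact_mod_cast (Nat.one_le_iff_ne_zero.1 hn)
  generalize algebraStableRank A = r at hrank
  induction r using ENat.recTopCoe with
  | top => rfl
  | coe s =>
    rw [ENat.map_natCast, ENat.map_natCast]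
    have hs : (1 : ℚ) ≤ s := by exact_mod_cast hrank
    have heq : ((s : ℚ) + n - 1) / n = (s - 1) / n + 1 := by field_simp; ring
    -- The ceiling takes values in `ℕ`, so pulling out the `1` uses `s ≥ 1`.
    rw [heq, Nat.ceil_add_one (div_nonneg (by linarith) n.cast_nonneg)]
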